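/- Directed stochastic sandpile. Let $L\in\mathbb N$, $p\in(0,1)$, $q=1-p$, $\alpha=pq$. On the sites $1,\dots,L$ a configuration consists of numbers $z(x)\in\{0,1\}$ of stable particles and $w(x)\in\mathbb N$ of waiting particles. A waiting particle at a site $x$ evolves as follows. If $z(x)=1$, the stable particle becomes waiting and one particle is transferred to $x+1$, so that $z(x)$ becomes $0$, $w(x)$ is unchanged and $w(x+1)$ increases by $1$. If $z(x)=0$, then with probability $p$ the waiting particle becomes stable ($z(x)$ becomes $1$ and $w(x)$ decreases by $1$), and with probability $q$ it jumps to $x+1$ ($w(x)$ decreases by $1$ and $w(x+1)$ increases by $1$). Particles arriving at $L+1$ leave the system. Each transfer of a particle from $x$ to $x+1$ is a toppling at $x$. A configuration is stable if $w\equiv 0$. An avalanche consists in adding one waiting particle at site $1$ to a stable configuration and evolving waiting particles one at a time until the configuration is stable; the site evolved next is chosen by an arbitrary fixed rule which assigns to each unstable configuration a site holding a waiting particle. Start from the stationary state, in which the $z(x)$ are independent and equal to $1$ with probability $p$ and there is no waiting particle, and perform avalanches numbered $0,1,2,\dots$ one after the other. Let $s(x,t)=s_x^t$ be the number of topplings at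 site $x$ during avalanche $t$, and let $\langle\cdot\rangle$ denote the expectation. For $2\le x\le L$, $t\ge 0$ and $\tau\ge 1$, let $\epsilon\in\{0,1\}$ be equal to $1$ if and only if at least one of the $\tau-1$ avalanches $t+1,\dots,t+\tau-1$ sends at least one particle from site $x-1$ to site $x$, and put $\theta(a,\tau-1)=P(\epsilon=1\mid s_{x-1}^t=a)$. Then, for all $L$, $p$, all rules as above, all $t\ge 0$ and all $\tau\ge 1$: 1. For every $2\le x\le L$, $$\langle s(x,t)s(x,t+\tau)\rangle=\langle s(x-1,t)s(x-1,t+\tau)\rangle-\alpha\sum_{a=1}^{x}\sum_{b=1}^{x}\bigl(1-\theta(a,\tau-1)\bigr)\,P\bigl(s_{x-1}^{t+\tau}=b\mid s_{x-1}^{t}=a,\ \epsilon=0\bigr)\,P\bigl(s_{x-1}^t=a\bigr),$$ where a term that contains a conditional probability given an event of probability zero is read as $0$. 2. The function $x\mapsto\langle s(x,t)s(x,t+\tau)\rangle$ is non-increasing on $\{1,\dots,L\}$. 3. The decrease is strict as long as $\tau\le x$: for every $2\le x\le L$ with $\tau\le x$, $\langle s(x,t)s(x,t+\tau)\rangle<\langle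 s(x-1,t)s(x-1,t+\tau)\rangle$. -/

import Mathlib

open MeasureTheory ProbabilityTheory

noncomputable section

namespace DSS

/-- The sites `1, …, L` of the chain. -/
abbrev Site (L : ℕ) : Type := {x : ℕ // x ∈ Finset.Icc 1 L}

/-- A generalised configuration: `w x` waiting particles at site `x`, and a stable particle
at `x` exactly when `z x = true`. -/
@[ext]
structure Config (L : ℕ) where
  w : Site L → ℕ
  z : Site L → Bool

/-- A configuration is stable when it has no waiting particle. -/
def Config.Stable {L : ℕ} (c : Config L) : Prop := ∀ x, c.w x = 0

/-- The operator `a_k`: add one waiting particle at site `k`. Outside the chain it does nothing,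
so a particle that reaches `L + 1` is lost. -/
def Config.add {L : ℕ} (k : ℕ) (c : Config L) : Config L :=
  ⟨fun y => c.w y + if (y : ℕ) = k then 1 else 0, c.z⟩

/-- Remove one waiting particle at site `x`. -/
def Config.remove {L : ℕ} (x : Site L) (c : Config L) : Config L :=
  ⟨fun y => c.w y - if y = x then 1 else 0, c.z⟩

/-- Set the stable occupation of site `x` to `b`. -/
def Config.setZ {L : ℕ} (x : Site L) (b : Bool) (c : Config L) : Config L :=
  ⟨c.w, Function.update c.z x b⟩

/-- The Bernoulli law with parameter `p` on `Bool`. -/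
def coin (p : Set.Ioo (0 : ℝ) 1) : PMF Bool :=
  PMF.ofFintype (fun b => if b then ENNReal.ofReal p else ENNReal.ofReal (1 - p)) (by
    have h0 : (0 : ℝ) ≤ p := p.2.1.le
    have h1 : (0 : ℝ) ≤ 1 - p := by linarith [p.2.2]
    rw [Fintype.sum_bool]
    simp only [if_true, Bool.false_eq_true, if_false]
    rw [← ENNReal.ofReal_add h0 h1]
    simp)

/-- A choice of the site to be evolved next, in every unstable configuration: some site which
holds a waiting particle. This is an evolution operator. -/
structure Evolution (L : ℕ) where
  site : (c : Config L) → ¬ c.Stable → Site L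
  waiting : ∀ (c : Config L) (h : ¬ c.Stable), 0 < c.w (site c h)

/-- A configuration together with the number of topplings performed so far at each site. -/
abbrev State (L : ℕ) : Type := Config L × (Site L → ℕ)

/-- Count one more toppling at `x`. -/
def count {L : ℕ} (x : Site L) (s : Site L → ℕ) : Site L → ℕ :=
  Function.update s x (s x + 1)

/-- One waiting particle at `x` evolves. If `z x = 1`, the stable particle becomes waiting and one
particle is transferred to `x + 1`: `a_x [1] → a_x a_{x+1} [0]`. If `z x = 0`, the waiting particle
becomes stable with probability `p` and jumps to `x + 1` with probability `1 - p`: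
`a_x [0] → p [1] + (1 - p) a_{x+1} [0]`. Each transfer to `x + 1` is a toppling at `x`. -/
def evolveAt {L : ℕ} (p : Set.Ioo (0 : ℝ) 1) (x : Site L) (σ : State L) : PMF (State L) :=
  if σ.1.z x then
    PMF.pure ((σ.1.setZ x false).add ((x : ℕ) + 1), count x σ.2)
  else
    (coin p).map fun b =>
      if b then ((σ.1.remove x).setZ x true, σ.2)
      else ((σ.1.remove x).add ((x : ℕ) + 1), count x σ.2)

open Classical in
/-- One application of the evolution operator; stable configurations are left unchanged. -/
def step {L : ℕ} (p : Set.Ioo (0 : ℝ) 1) (e : Evolution L) (σ : State L) : PMF (State L) :=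
  if h : σ.1.Stable then PMF.pure σ else evolveAt p (e.site σ.1 h) σ

/-- `n` applications of the evolution operator. -/
def iter {L : ℕ} (p : Set.Ioo (0 : ℝ) 1) (e : Evolution L) : ℕ → State L → PMF (State L)
  | 0, σ => PMF.pure σ
  | n + 1, σ => (step p e σ).bind (iter p e n)

/-- A quantity which decreases at every evolution of a particle, and so bounds the number of
steps before stabilisation. -/
def Config.potential {L : ℕ} (c : Config L) : ℕ :=
  ∑ x : Site L, (2 * (L + 1 - (x : ℕ)) * c.w x + (2 * (L + 1 - (x : ℕ)) - 1) * (c.z x).toNat)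

lemma potential_add {L : ℕ} (k : ℕ) (hk : 1 ≤ k) (c : Config L) :
    (c.add k).potential = c.potential + 2 * (L + 1 - k) := by
  unfold Config.potential Config.add
  have h : ∑ x : Site L, (if (x : ℕ) = k then 2 * (L + 1 - k) else 0) = 2 * (L + 1 - k) := by
    by_cases hL : k ≤ L
    · rw [Finset.sum_eq_single (⟨k, Finset.mem_Icc.2 ⟨hk, hL⟩⟩ : Site L)]
      · simp
      · intro b _ hb
        rw [if_neg]
        intro h
        exact hb (Subtype.ext h)
      · simp
    · have : L + 1 - k = 0 := by omega
      simp [this]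
  conv_rhs => rw [← h]
  rw [← Finset.sum_add_distrib]
  refine Finset.sum_congr rfl fun x _ => ?_
  by_cases hx : (x : ℕ) = k
  · simp only [hx, if_true]; ring
  · simp only [hx, if_false]; ring

lemma potential_remove {L : ℕ} (x : Site L) (c : Config L) (hx : 0 < c.w x) :
    (c.remove x).potential + 2 * (L + 1 - (x : ℕ)) = c.potential := by
  unfold Config.potential Config.remove
  have h : ∑ y : Site L, (if y = x then 2 * (L + 1 - (x : ℕ)) else 0)
      = 2 * (L + 1 - (x : ℕ)) := by simp
  conv_lhs => rw [← h]
  rw [← Finset.sum_add_distrib]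
  refine Finset.sum_congr rfl fun y _ => ?_
  by_cases hy : y = x
  · subst hy
    obtain ⟨m, hm⟩ : ∃ m, c.w y = m + 1 := ⟨c.w y - 1, by omega⟩
    simp only [hm, if_true, Nat.add_sub_cancel]; ring
  · simp only [hy, if_false]; rfl

lemma potential_setZ {L : ℕ} (x : Site L) (b : Bool) (c : Config L) :
    (c.setZ x b).potential + (2 * (L + 1 - (x : ℕ)) - 1) * (c.z x).toNat
      = c.potential + (2 * (L + 1 - (x : ℕ)) - 1) * b.toNat := by
  unfold Config.potential Config.setZ
  rw [← Finset.add_sum_erase _ _ (Finset.mem_univ x),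
    ← Finset.add_sum_erase _ _ (Finset.mem_univ x)]
  have : ∀ y ∈ Finset.univ.erase x,
      (2 * (L + 1 - (y : ℕ)) * c.w y
        + (2 * (L + 1 - (y : ℕ)) - 1) * (Function.update c.z x b y).toNat)
      = (2 * (L + 1 - (y : ℕ)) * c.w y + (2 * (L + 1 - (y : ℕ)) - 1) * (c.z y).toNat) := by
    intro y hy
    rw [Function.update_of_ne (Finset.ne_of_mem_erase hy)]
  rw [Finset.sum_congr rfl this]
  simp only [Function.update_self]
  ring

lemma potential_step {L : ℕ} (p : Set.Ioo (0 : ℝ) 1) (e : Evolution L) (σ σ' : State L)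
    (h : ¬ σ.1.Stable) (hσ : σ' ∈ (step p e σ).support) :
    σ'.1.potential < σ.1.potential := by
  rw [step, dif_neg h] at hσ
  have hw := e.waiting σ.1 h
  generalize e.site σ.1 h = x at hσ hw
  have hx := Finset.mem_Icc.1 x.2
  unfold evolveAt at hσ
  split_ifs at hσ with hz
  · rw [PMF.support_pure, Set.mem_singleton_iff] at hσ
    subst hσ
    have h1 := potential_setZ x false σ.1
    rw [hz] at h1
    simp only [Bool.toNat_true, Bool.toNat_false] at h1
    have h2 := potential_add ((x : ℕ) + 1) (by omega) (σ.1.setZ x false)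
    simp only
    omega
  · rw [PMF.support_map] at hσ
    obtain ⟨b, -, rfl⟩ := hσ
    have h1 := potential_remove x σ.1 hw
    cases b
    · have h2 := potential_add ((x : ℕ) + 1) (by omega) (σ.1.remove x)
      simp only [Bool.false_eq_true, if_false]
      omega
    · have h2 := potential_setZ x true (σ.1.remove x)
      have h3 : (σ.1.remove x).z x = false := by simpa [Config.remove] using hz
      rw [h3] at h2
      simp only [Bool.toNat_true, Bool.toNat_false] at h2
      simp only [if_true]
      omega

lemma iter_of_stable {L : ℕ} (p : Set.Ioo (0 : ℝ) 1) (e : Evolution L) (n : ℕ) (σ : State L)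
    (h : σ.1.Stable) : iter p e n σ = PMF.pure σ := by
  induction n with
  | zero => rfl
  | succ n ih => rw [iter, step, dif_pos h, PMF.pure_bind, ih]

/-- After `c.potential` steps (or more) the configuration is stable, so that the iterates of the
evolution operator have then reached their limit. -/
theorem stable_of_mem_iter {L : ℕ} (p : Set.Ioo (0 : ℝ) 1) (e : Evolution L) (n : ℕ)
    (σ σ' : State L) (hn : σ.1.potential ≤ n) (h : σ' ∈ (iter p e n σ).support) :
    σ'.1.Stable := by
  induction n generalizing σ with
  | zero =>
    rw [iter, PMF.support_pure, Set.mem_singleton_iff] at h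
    subst h
    by_contra hs
    obtain ⟨τ, hτ⟩ := (step p e σ').support_nonempty
    have := potential_step p e σ' τ hs hτ
    omega
  | succ n ih =>
    by_cases hs : σ.1.Stable
    · rw [iter_of_stable p e _ σ hs, PMF.support_pure, Set.mem_singleton_iff] at h
      subst h
      exact hs
    · rw [iter, PMF.mem_support_bind_iff] at h
      obtain ⟨τ, hτ, h⟩ := h
      have := potential_step p e σ τ hs hτ
      exact ih τ (by omega) h

/-- Stabilisation: the limit of the iterates of the evolution operator. -/
def stabilize {L : ℕ} (p : Set.Ioo (0 : ℝ) 1) (e : Evolution L) (σ : State L) : PMF (State L) :=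
  iter p e σ.1.potential σ

/-- One avalanche from the stable configuration `z`: add one waiting particle at site `1` and
stabilise. The result is the joint law of the new stable configuration and of the number of
topplings at each site. -/
def avalanche {L : ℕ} (p : Set.Ioo (0 : ℝ) 1) (e : Evolution L) (z : Site L → Bool) :
    PMF ((Site L → Bool) × (Site L → ℕ)) :=
  (stabilize p e ((Config.add 1 ⟨fun _ => 0, z⟩ : Config L), fun _ => 0)).map
    fun σ => (σ.1.z, σ.2)

/-- The stationary state: every site is occupied with probability `p`, independently. -/
def stationary (L : ℕ) (p : Set.Ioo (0 : ℝ) 1) : PMF (Site L → Bool) :=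
  PMF.ofFintype (fun z => ∏ x, coin p (z x)) (by
    have h : ∑ b : Bool, coin p b = 1 := by
      have := (coin p).tsum_coe
      rwa [tsum_fintype] at this
    have := Finset.prod_univ_sum (fun _ : Site L => (Finset.univ : Finset Bool))
      (fun _ b => coin p b)
    rw [Fintype.piFinset_univ] at this
    rw [← this, h, Finset.prod_const_one])

/-- The current stable configuration, and the record of the topplings: `ω.2 t x` is the number of
topplings at site `x` in avalanche number `t`. -/
abbrev Record (L : ℕ) : Type := (Site L → Bool) × (ℕ → Site L → ℕ)

/-- The law of the record of the avalanches `0, …, n - 1`, one after the other, from the stationary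
state. (The entries of the later avalanches are `0`.) -/
def run (L : ℕ) (p : Set.Ioo (0 : ℝ) 1) (e : Evolution L) : ℕ → PMF (Record L)
  | 0 => (stationary L p).map fun z => (z, fun _ _ => 0)
  | n + 1 => (run L p e n).bind fun ω =>
      (avalanche p e ω.1).map fun r => (r.1, Function.update ω.2 n r.2)

/-- The probability measure which governs the avalanches `0, …, t`. -/
def law (L : ℕ) (p : Set.Ioo (0 : ℝ) 1) (e : Evolution L) (t : ℕ) : Measure (Record L) :=
  (run L p e (t + 1)).toMeasure

/-- `s(x, t)`: the number of topplings at site `x` in avalanche `t` (for `1 ≤ x ≤ L`). -/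
def s {L : ℕ} (x t : ℕ) (ω : Record L) : ℕ :=
  if hx : x ∈ Finset.Icc 1 L then ω.2 t ⟨x, hx⟩ else 0

/-- The two-point function `⟨s(x, t) s(x, t + τ)⟩`. -/
def corr (L : ℕ) (p : Set.Ioo (0 : ℝ) 1) (e : Evolution L) (x t τ : ℕ) : ℝ :=
  ∫ ω, (s x t ω : ℝ) * (s x (t + τ) ω : ℝ) ∂(law L p e (t + τ))

/-- The event `ε = 1`: one of the `τ - 1` avalanches strictly between `t` and `t + τ` sends at
least one particle from site `y` to site `y + 1`. -/
def reached (L y t τ : ℕ) : Set (Record L) :=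
  {ω | ∃ u, t < u ∧ u < t + τ ∧ 1 ≤ s y u ω}

/-- The event `s(y, t) = a`. -/
def toppled (L y t a : ℕ) : Set (Record L) := {ω | s y t ω = a}

/-- `θ(a, τ - 1)`: the probability of `ε = 1` given `s(y, t) = a`. -/
def theta (L : ℕ) (p : Set.Ioo (0 : ℝ) 1) (e : Evolution L) (y t τ a : ℕ) : ℝ :=
  ((law L p e (t + τ))[|toppled L y t a]).real (reached L y t τ)

end DSS

end

/-!
The proof rests on a description of the avalanches by independent Bernoulli bits.

Give every site a fresh bit of parameter `p` and stabilise the sites from left to right. If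
`n ≥ 1` particles arrive at a site, its final occupation may be taken to be the fresh bit, whatever
its occupation `z` was, and by conservation it sends on `n + z - ξ` particles, `ξ` being the bit; if
`n = 0`, nothing happens. This canonical law is harmonic for the evolution of any waiting particle
(`evolveAt_bind_canonical`), because the coin used in the evolution can be exchanged with the fresh
bit. Hence it is the law of the stable state for every evolution rule (`stabilize_eq_canonical`), and
the record of all avalanches is a function of an array of independent bits (`run_eq`).

In this array the arrivals `n u` at site `x` in avalanche `u` depend only on the bits of the sites
before `x`. These being fixed, the occupation of `x` before avalanche `u` is the bit drawn at the
last visit of `x`, or the initial one. If avalanches `t` and `t + τ` both visit `x`, the mean of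
`(n t + z₀ - z₁) * (n (t + τ) + z₂ - z₃)` is therefore `n t * n (t + τ)`, except when no avalanche
in between visits `x`. Then `z₂ = z₁`, and the covariance of `-z₁` and `z₂` lowers the mean by
`p * (1 - p)`. As `n u` is the number of topplings at `x - 1`, this is the recursion `corr_succ`,
whose loss term is `p * (1 - p)` times the probability of the event `returns`. The double sum of the
statement is this probability, decomposed by the numbers of topplings and the chain rule.

The decrease follows at once, and is strict when `returns` has positive probability. All arrays of
bits have positive weight, so that one array in this event is enough: after avalanche `t` the sites
before `x` are empty, the next `τ - 1 ≤ x - 1` avalanches fill them from the right one by one, and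
avalanche `t + τ` passes through (`fillingBits`).
-/

namespace DSS

/-! ### Independent Bernoulli bits -/

/-- Resampling a block of independent bits: overwriting the bits along `f` by an independent copy
does not change the law of the family. Only the weights `c` of a single bit enter, so that the lemma
serves both for laws (in `ℝ≥0∞`) and for expectations (in `ℝ`). -/
lemma sum_extend {I J R : Type*} [Fintype I] [Fintype J] [DecidableEq I] [DecidableEq J]
    [CommSemiring R] (c : Bool → R) {f : J → I} (hf : f.Injective) (F : (I → Bool) → R) :
    ∑ η : I → Bool, (∏ i, c (η i)) * ∑ ξ : J → Bool, (∏ j, c (ξ j)) * F (Function.extend f ξ η)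
      = ∑ η : I → Bool, (∏ i, c (η i)) * ∑ ξ : J → Bool, (∏ j, c (ξ j)) * F η := by
  -- Exchanging the block with the copy is an involution which preserves the product weight.
  have hinv : Function.Involutive (fun a : (I → Bool) × (J → Bool) =>
      (Function.extend f a.2 a.1, a.1 ∘ f)) := by
    rintro ⟨η, ξ⟩
    refine Prod.ext (funext fun i => ?_) (funext fun j => ?_)
    · by_cases h : ∃ j, f j = i
      · obtain ⟨j, rfl⟩ := h
        simp [hf.extend_apply]
      · simp [Function.extend_apply' _ _ _ h]
    · simp [hf.extend_apply]
  have hw : ∀ (η : I → Bool) (ξ : J → Bool),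
      (∏ i, c (Function.extend f ξ η i)) * ∏ j, c (η (f j)) = (∏ i, c (η i)) * ∏ j, c (ξ j) := by
    intro η ξ
    have split : ∀ g : I → R, ∏ i, g i
        = (∏ j, g (f j)) * ∏ i ∈ (Finset.univ.image f)ᶜ, g i := by
      intro g
      rw [← Finset.prod_image (f := g) (s := Finset.univ) (g := f) (fun a _ b _ h => hf h),
        Finset.prod_mul_prod_compl]
    rw [split (fun i => c (Function.extend f ξ η i)), split (fun i => c (η i))]
    have : ∏ i ∈ (Finset.univ.image f)ᶜ, c (Function.extend f ξ η i)
        = ∏ i ∈ (Finset.univ.image f)ᶜ, c (η i) := by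
      refine Finset.prod_congr rfl fun i hi => ?_
      rw [Function.extend_apply']
      simpa using hi
    rw [this]
    simp only [hf.extend_apply]
    ring
  simp only [Finset.mul_sum, ← mul_assoc]
  rw [← Fintype.sum_prod_type', ← Fintype.sum_prod_type']
  refine Fintype.sum_equiv hinv.toPerm _ _ fun a => ?_
  simp only [Function.Involutive.coe_toPerm, Function.comp_apply, hw]

/-- The law of a family of independent Bernoulli variables with parameter `p`, indexed by `I`. -/
noncomputable def bits (p : Set.Ioo (0 : ℝ) 1) (I : Type*) [Fintype I] [DecidableEq I] :
    PMF (I → Bool) :=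
  PMF.ofFintype (fun z => ∏ x, coin p (z x)) (by
    have h : ∑ b : Bool, coin p b = 1 := by
      have := (coin p).tsum_coe
      rwa [tsum_fintype] at this
    have := Finset.prod_univ_sum (fun _ : I => (Finset.univ : Finset Bool))
      (fun _ b => coin p b)
    rw [Fintype.piFinset_univ] at this
    rw [← this, h, Finset.prod_const_one])

lemma stationary_eq_bits (L : ℕ) (p : Set.Ioo (0 : ℝ) 1) : stationary L p = bits p (Site L) := rfl

lemma extend_const_unit {I : Type*} [DecidableEq I] (i : I) (b : Bool) (η : I → Bool) :
    Function.extend (fun _ : Unit => i) (fun _ => b) η = Function.update η i b := by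
  funext k
  by_cases h : k = i
  · subst h
    rw [Function.update_self]
    exact (show Function.Injective (fun _ : Unit => k) from fun _ _ _ => rfl).extend_apply
      (fun _ => b) η ()
  · rw [Function.update_of_ne h, Function.extend_apply']
    rintro ⟨_, h'⟩
    exact h h'.symm

section

variable {I J : Type*} [Fintype I] [DecidableEq I] [Fintype J] [DecidableEq J]

lemma bits_apply (p : Set.Ioo (0 : ℝ) 1) (η : I → Bool) : bits p I η = ∏ i, coin p (η i) := rfl

lemma sum_bits (p : Set.Ioo (0 : ℝ) 1) : ∑ η : I → Bool, ∏ i, coin p (η i) = 1 := by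
  have := (bits p I).tsum_coe
  rwa [tsum_fintype] at this

lemma bits_bind_extend (p : Set.Ioo (0 : ℝ) 1) {f : J → I} (hf : f.Injective)
    {β : Type*} (g : (I → Bool) → PMF β) :
    ((bits p I).bind fun η => (bits p J).bind fun ξ => g (Function.extend f ξ η))
      = (bits p I).bind g := by
  ext b
  simp only [PMF.bind_apply, tsum_fintype, bits_apply]
  rw [sum_extend (coin p) hf (fun η => g η b)]
  simp only [← Finset.sum_mul, sum_bits, one_mul]

lemma bits_bind_update (p : Set.Ioo (0 : ℝ) 1) (i : I) {β : Type*} (g : (I → Bool) → PMF β) :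
    ((bits p I).bind fun η => (coin p).bind fun b => g (Function.update η i b))
      = (bits p I).bind g := by
  rw [← bits_bind_extend p (f := fun _ : Unit => i) (fun _ _ _ => rfl) g]
  congr 1
  funext η
  ext y
  simp only [PMF.bind_apply, tsum_fintype, bits_apply]
  refine Fintype.sum_equiv (Equiv.funUnique Unit Bool).symm _ _ fun b => ?_
  have : (Equiv.funUnique Unit Bool).symm b = fun _ => b := rfl
  rw [this, extend_const_unit]
  simp

/-- A bit may be resampled on an event that does not depend on it, and kept elsewhere. -/
lemma bits_bind_update_if (p : Set.Ioo (0 : ℝ) 1) (i : I) {β : Type*} (g : (I → Bool) → PMF β)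
    (P : (I → Bool) → Prop) [DecidablePred P] (hP : ∀ η b, P (Function.update η i b) ↔ P η) :
    ((bits p I).bind fun η => (coin p).bind fun b =>
        g (if P η then Function.update η i b else η))
      = (bits p I).bind g := by
  rw [← bits_bind_update p i, ← bits_bind_update p i g]
  congr 1
  funext η
  by_cases h : P η
  · simp [hP, h]
  · simp [hP, h]

/-- The expectation of `f` under independent Bernoulli bits, written as a finite sum. -/
noncomputable def mean (p : Set.Ioo (0 : ℝ) 1) (f : (I → Bool) → ℝ) : ℝ :=
  ∑ η : I → Bool, (∏ i, (coin p (η i)).toReal) * f η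

lemma coin_true (p : Set.Ioo (0 : ℝ) 1) : (coin p true).toReal = p := by
  simp [coin, PMF.ofFintype_apply, p.2.1.le]

lemma coin_false (p : Set.Ioo (0 : ℝ) 1) : (coin p false).toReal = 1 - p := by
  simp [coin, PMF.ofFintype_apply, p.2.2.le]

lemma coin_toReal_pos (p : Set.Ioo (0 : ℝ) 1) (b : Bool) : 0 < (coin p b).toReal := by
  cases b
  · rw [coin_false]; linarith [p.2.2]
  · rw [coin_true]; exact p.2.1

lemma mean_const (p : Set.Ioo (0 : ℝ) 1) (a : ℝ) : mean p (fun _ : I → Bool => a) = a := by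
  unfold mean
  rw [← Finset.sum_mul]
  have := Finset.prod_univ_sum (fun _ : I => (Finset.univ : Finset Bool))
    (fun _ b => (coin p b).toReal)
  rw [Fintype.piFinset_univ] at this
  rw [← this]
  simp [coin_true, coin_false]

lemma mean_add (p : Set.Ioo (0 : ℝ) 1) (f g : (I → Bool) → ℝ) :
    mean p (fun η => f η + g η) = mean p f + mean p g := by
  simp [mean, mul_add, Finset.sum_add_distrib]

lemma mean_sub (p : Set.Ioo (0 : ℝ) 1) (f g : (I → Bool) → ℝ) :
    mean p (fun η => f η - g η) = mean p f - mean p g := by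
  simp [mean, mul_sub, Finset.sum_sub_distrib]

lemma mean_mul_left (p : Set.Ioo (0 : ℝ) 1) (a : ℝ) (f : (I → Bool) → ℝ) :
    mean p (fun η => a * f η) = a * mean p f := by
  simp only [mean, Finset.mul_sum]
  exact Finset.sum_congr rfl fun _ _ => by ring

lemma mean_sum (p : Set.Ioo (0 : ℝ) 1) {ι : Type*} (S : Finset ι) (f : ι → (I → Bool) → ℝ) :
    mean p (fun η => ∑ k ∈ S, f k η) = ∑ k ∈ S, mean p (f k) := by
  simp only [mean, Finset.mul_sum]
  exact Finset.sum_comm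

lemma mean_pos (p : Set.Ioo (0 : ℝ) 1) {f : (I → Bool) → ℝ} (hf : ∀ η, 0 ≤ f η)
    (η : I → Bool) (hη : 0 < f η) : 0 < mean p f :=
  Finset.sum_pos' (fun η _ =>
    mul_nonneg (Finset.prod_nonneg fun _ _ => ENNReal.toReal_nonneg) (hf η))
    ⟨η, Finset.mem_univ _, mul_pos (Finset.prod_pos fun _ _ => coin_toReal_pos p _) hη⟩

lemma mean_extend (p : Set.Ioo (0 : ℝ) 1) {f : J → I} (hf : f.Injective) (F : (I → Bool) → ℝ) :
    mean p (fun η : I → Bool => mean p fun ξ : J → Bool => F (Function.extend f ξ η))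
      = mean p F := by
  unfold mean
  rw [sum_extend (fun b => (coin p b).toReal) hf]
  refine Finset.sum_congr rfl fun η _ => ?_
  have := mean_const (I := J) p (F η)
  unfold mean at this
  rw [this]

lemma mean_update (p : Set.Ioo (0 : ℝ) 1) (i : I) (F : (I → Bool) → ℝ) :
    mean p F = mean p fun η =>
      p * F (Function.update η i true) + (1 - p) * F (Function.update η i false) := by
  rw [← mean_extend p (f := fun _ : Unit => i) (fun _ _ _ => rfl) F]
  congr 1
  funext η
  unfold mean
  rw [← Fintype.sum_equiv (Equiv.funUnique Unit Bool).symm (fun b => (coin p b).toReal *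
    F (Function.update η i b)) _ fun b => ?_]
  · simp [coin_true, coin_false]
  · have : (Equiv.funUnique Unit Bool).symm b = fun _ => b := rfl
    rw [this]
    beta_reduce
    rw [extend_const_unit]
    simp

lemma mean_bit (p : Set.Ioo (0 : ℝ) 1) (i : I) :
    mean p (fun η : I → Bool => ((η i).toNat : ℝ)) = p := by
  rw [mean_update p i]
  simp [mean_const]

lemma mean_bit_mul_bit (p : Set.Ioo (0 : ℝ) 1) (i j : I) :
    mean p (fun η : I → Bool => ((η i).toNat : ℝ) * (η j).toNat)
      = if i = j then (p : ℝ) else (p : ℝ) ^ 2 := by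
  rw [mean_update p i]
  split_ifs with h
  · subst h
    simp [mean_const]
  · simp [Function.update_of_ne (Ne.symm h), mean_mul_left, mean_bit, sq]

lemma integral_bits (p : Set.Ioo (0 : ℝ) 1) (f : (I → Bool) → ℝ) :
    ∫ η, f η ∂(bits p I).toMeasure = mean p f := by
  rw [PMF.integral_eq_sum]
  simp [mean, bits_apply, ENNReal.toReal_prod]

/-- The product `(A + X_i - X_j) (B + X_k - X_m)` of two net fluxes through a site, with
independent bits `X`: the covariance is carried by the bit `X_j = X_k` which the two share. -/
lemma mean_flux_mul_flux (p : Set.Ioo (0 : ℝ) 1) (A B : ℝ) {i j k m : I}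
    (him : i ≠ m) (hik : i ≠ k) (hjm : j ≠ m) :
    mean p (fun η : I → Bool => (A + (η i).toNat - (η j).toNat) * (B + (η k).toNat - (η m).toNat))
      = A * B - p * (1 - p) * if k = j then 1 else 0 := by
  have h : (fun η : I → Bool =>
      (A + (η i).toNat - (η j).toNat) * (B + (η k).toNat - (η m).toNat))
      = fun η => A * B + A * (η k).toNat - A * (η m).toNat + B * (η i).toNat - B * (η j).toNat
        + ((η i).toNat : ℝ) * (η k).toNat - ((η i).toNat : ℝ) * (η m).toNat
        - ((η j).toNat : ℝ) * (η k).toNat + ((η j).toNat : ℝ) * (η m).toNat := by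
    funext η; ring
  rw [h]
  simp only [mean_add, mean_sub, mean_mul_left, mean_const, mean_bit, mean_bit_mul_bit,
    if_neg hik, if_neg him, if_neg hjm, eq_comm (a := j) (b := k)]
  split_ifs <;> ring

end

/-! ### The abelian property -/

/-- The number of particles which a site sends on when `n` particles arrive, the stable
occupation being `a` before and `b` after. The subtraction is not truncated, as `b ≤ 1 ≤ n` when
`n` is not zero. -/
def flow (n : ℕ) (a b : Bool) : ℕ := if n = 0 then 0 else n + a.toNat - b.toNat

/-- The number of topplings at site `k` during the stabilisation of `c`, sites being stabilised
from left to right, when `ξ x` is the final occupation of each visited site `x`. A visited site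
sends on what it receives, up to the change of its occupation. The value is `0` off the chain. -/
def out {L : ℕ} (c : Config L) (ξ : Site L → Bool) : ℕ → ℕ
  | 0 => 0
  | k + 1 => if h : k + 1 ∈ Finset.Icc 1 L then
      flow (c.w ⟨k + 1, h⟩ + out c ξ k) (c.z ⟨k + 1, h⟩) (ξ ⟨k + 1, h⟩) else 0

/-- The number of particles that site `x` receives: those waiting there and those sent by
`x - 1`. -/
def inflow {L : ℕ} (c : Config L) (ξ : Site L → Bool) (x : Site L) : ℕ :=
  c.w x + out c ξ ((x : ℕ) - 1)

lemma out_site {L : ℕ} (c : Config L) (ξ : Site L → Bool) (x : Site L) :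
    out c ξ x = flow (inflow c ξ x) (c.z x) (ξ x) := by
  obtain ⟨k, hk⟩ := x
  obtain ⟨k, rfl⟩ : ∃ m, k = m + 1 := ⟨k - 1, by have := Finset.mem_Icc.1 hk; omega⟩
  simp [out, hk, inflow]

lemma out_congr {L : ℕ} {c c' : Config L} {ξ ξ' : Site L → Bool} (k : ℕ)
    (h : ∀ y : Site L, (y : ℕ) ≤ k → c'.w y = c.w y ∧ c'.z y = c.z y ∧ ξ' y = ξ y) :
    out c' ξ' k = out c ξ k := by
  induction k with
  | zero => rfl
  | succ k ih =>
    unfold out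
    split_ifs with hk
    · obtain ⟨h1, h2, h3⟩ := h ⟨k + 1, hk⟩ le_rfl
      rw [h1, h2, h3, ih fun y hy => h y (by omega)]
    · rfl

/-- The stable state reached from `σ` when `ξ x` is the final occupation of each visited
site `x`. -/
def settle {L : ℕ} (σ : State L) (ξ : Site L → Bool) : State L :=
  (⟨fun _ => 0, fun x => if inflow σ.1 ξ x = 0 then σ.1.z x else ξ x⟩,
    fun x => σ.2 x + out σ.1 ξ x)

lemma settle_of_stable {L : ℕ} (σ : State L) (ξ : Site L → Bool) (h : σ.1.Stable) :
    settle σ ξ = σ := by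
  have hout : ∀ k, out σ.1 ξ k = 0 := by
    intro k
    induction k with
    | zero => rfl
    | succ k ih =>
      unfold out
      split_ifs with hk
      · simp [ih, h _, flow]
      · rfl
  refine Prod.ext (Config.ext (funext fun x => (h x).symm) (funext fun x => ?_))
    (funext fun x => ?_)
  · simp [settle, inflow, h x, hout]
  · simp [settle, hout]

/-- If `σ'` is ahead of `σ` by `d` topplings at `x`, and the stabilisation at `x` from `σ'` makes up
exactly for this difference, then both have the same outcome. -/
lemma settle_congr {L : ℕ} {σ σ' : State L} {ξ ξ' : Site L → Bool} (x : Site L) (d : ℕ)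
    (hs : ∀ y, σ'.2 y = σ.2 y + if y = x then d else 0)
    (hw : ∀ y, y ≠ x → σ'.1.w y = σ.1.w y + if (y : ℕ) = x + 1 then d else 0)
    (hz : ∀ y, y ≠ x → σ'.1.z y = σ.1.z y) (hξ : ∀ y, y ≠ x → ξ' y = ξ y)
    (hflow : flow (σ'.1.w x + out σ.1 ξ (x - 1)) (σ'.1.z x) (ξ' x) + d
      = flow (σ.1.w x + out σ.1 ξ (x - 1)) (σ.1.z x) (ξ x))
    (hocc : (if σ'.1.w x + out σ.1 ξ (x - 1) = 0 then σ'.1.z x else ξ' x)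
      = if σ.1.w x + out σ.1 ξ (x - 1) = 0 then σ.1.z x else ξ x) :
    settle σ' ξ' = settle σ ξ := by
  have hx := Finset.mem_Icc.1 x.2
  have hbefore : out σ'.1 ξ' (x - 1) = out σ.1 ξ (x - 1) := by
    refine out_congr _ fun y hy => ?_
    have hyx : y ≠ x := by rintro rfl; omega
    refine ⟨?_, hz y hyx, hξ y hyx⟩
    rw [hw y hyx, if_neg (by omega), add_zero]
  have hout : ∀ k, out σ'.1 ξ' k + (if k = (x : ℕ) then d else 0) = out σ.1 ξ k := by
    intro k
    induction k with
    | zero => rw [if_neg (by omega)]; rfl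
    | succ k ih =>
      by_cases hk : k + 1 ∈ Finset.Icc 1 L
      · by_cases hkx : (⟨k + 1, hk⟩ : Site L) = x
        · have hkx' : k + 1 = (x : ℕ) := congrArg Subtype.val hkx
          rw [if_pos hkx', hkx', out_site, out_site, inflow, inflow, hbefore]
          exact hflow
        · have hkx' : k + 1 ≠ (x : ℕ) := fun h => hkx (Subtype.ext h)
          rw [if_neg hkx']
          simp only [out, dif_pos hk, hw _ hkx, hz _ hkx, hξ _ hkx, add_zero, ← ih,
            Nat.add_right_cancel_iff]
          congr 1
          ring
      · rw [if_neg (by rintro h; rw [h] at hk; exact hk x.2)]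
        simp [out, hk]
  refine Prod.ext (Config.ext rfl (funext fun y => ?_)) (funext fun y => ?_)
  · simp only [settle]
    by_cases hy : y = x
    · subst hy
      rw [inflow, inflow, hbefore]
      exact hocc
    · have hin : inflow σ'.1 ξ' y = inflow σ.1 ξ y := by
        have hy1 := Finset.mem_Icc.1 y.2
        rw [inflow, inflow, hw y hy, ← hout]
        have : ((y : ℕ) - 1 = x) ↔ ((y : ℕ) = x + 1) := by omega
        simp only [this]
        ring
      rw [hin, hz y hy, hξ y hy]
  · simp only [settle]
    rw [hs y, ← hout y]
    simp only [Subtype.ext_iff]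
    ring

/-- The canonical stabilisation: every visited site receives a fresh Bernoulli occupation. -/
noncomputable def canonical {L : ℕ} (p : Set.Ioo (0 : ℝ) 1) (σ : State L) : PMF (State L) :=
  (bits p (Site L)).map (settle σ)

lemma canonical_of_stable {L : ℕ} (p : Set.Ioo (0 : ℝ) 1) (σ : State L) (h : σ.1.Stable) :
    canonical p σ = PMF.pure σ := by
  rw [canonical, show settle σ = Function.const _ σ from
    funext fun ξ => settle_of_stable σ ξ h, PMF.map_const]

/-- Evolving a waiting particle does not change the law of the canonical outcome. If the site is
occupied, the outcome is unchanged for all fresh bits. If it is empty, the coin of the evolution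
plays the part of the fresh bit of the site when the site receives no other particle, and is
overwritten otherwise. -/
lemma evolveAt_bind_canonical {L : ℕ} (p : Set.Ioo (0 : ℝ) 1) (x : Site L) (σ : State L)
    (hx : 0 < σ.1.w x) : (evolveAt p x σ).bind (canonical p) = canonical p σ := by
  unfold evolveAt
  split_ifs with hz
  · rw [PMF.pure_bind, canonical, canonical]
    congr 1
    funext ξ
    refine settle_congr x 1 ?_ ?_ ?_ (fun _ _ => rfl) ?_ ?_
    · intro y
      by_cases hy : y = x
      · subst hy; simp [count]
      · simp [count, hy]
    · intro y hy
      simp [Config.add, Config.setZ]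
    · intro y hy
      simp [Config.add, Config.setZ, hy]
    · simp only [Config.add, Config.setZ, hz, Function.update_self, flow]
      cases ξ x <;> simp <;> split_ifs <;> omega
    · simp only [Config.add, Config.setZ]
      simp [hx.ne']
  · rw [Bool.not_eq_true] at hz
    -- `P` says that `x` receives no other particle; it does not depend on the fresh bit at `x`.
    set P : (Site L → Bool) → Prop := fun ξ => inflow σ.1 ξ x = 1 with hPdef
    have hout : ∀ (ξ : Site L → Bool) (b : Bool),
        out σ.1 (Function.update ξ x b) ((x : ℕ) - 1) = out σ.1 ξ ((x : ℕ) - 1) := by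
      intro ξ b
      have hx1 := Finset.mem_Icc.1 x.2
      refine out_congr _ fun y hy => ⟨rfl, rfl, ?_⟩
      rw [Function.update_of_ne]
      rintro rfl
      omega
    have hP : ∀ ξ b, P (Function.update ξ x b) ↔ P ξ := by
      intro ξ b
      simp only [hPdef, inflow, hout]
    rw [PMF.bind_map, canonical, ← PMF.bind_pure_comp (settle σ),
      ← bits_bind_update_if p x _ P hP, PMF.bind_comm]
    congr 1
    funext b
    simp only [Function.comp_apply, canonical, ← PMF.bind_pure_comp]
    congr 1
    funext ξ
    -- From here on the fresh bits are fixed, and `η` are those which give `σ` the same outcome.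
    set η : Site L → Bool := if P ξ then Function.update ξ x b else ξ with hη
    have hηo : out σ.1 η ((x : ℕ) - 1) = out σ.1 ξ ((x : ℕ) - 1) := by
      rw [hη]; split_ifs
      · exact hout ξ b
      · rfl
    have hηy : ∀ y, y ≠ x → ξ y = η y := by
      intro y hy
      rw [hη]; split_ifs
      · rw [Function.update_of_ne hy]
      · rfl
    have hηx : η x = if P ξ then b else ξ x := by
      rw [hη]; split_ifs
      · rw [Function.update_self]
      · rfl
    simp only [hPdef, inflow, ← hηo] at hηx
    refine congrArg PMF.pure (settle_congr x (if b then 0 else 1) ?_ ?_ ?_ hηy ?_ ?_)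
    · intro y
      cases b
      · by_cases hy : y = x
        · subst hy; simp [count]
        · simp [count, hy]
      · simp
    · intro y hy
      cases b <;> simp [Config.add, Config.setZ, Config.remove, hy]
    · intro y hy
      cases b <;> simp [Config.add, Config.setZ, Config.remove, hy]
    · generalize out σ.1 η ((x : ℕ) - 1) = o at hηx ⊢
      obtain ⟨m, hm⟩ : ∃ m, σ.1.w x = m + 1 := ⟨σ.1.w x - 1, by omega⟩
      by_cases h : m = 0 ∧ o = 0
      · obtain ⟨rfl, rfl⟩ := h
        rw [hηx]
        cases b <;> simp [Config.add, Config.setZ, Config.remove, hz, hm, flow]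
      · rw [if_neg (show ¬ σ.1.w x + o = 1 by omega)] at hηx
        rw [hηx]
        cases b <;> cases ξ x <;>
          simp [Config.add, Config.setZ, Config.remove, hz, hm, flow, h] <;> omega
    · generalize out σ.1 η ((x : ℕ) - 1) = o at hηx ⊢
      obtain ⟨m, hm⟩ : ∃ m, σ.1.w x = m + 1 := ⟨σ.1.w x - 1, by omega⟩
      by_cases h : m = 0 ∧ o = 0
      · obtain ⟨rfl, rfl⟩ := h
        rw [hηx]
        cases b <;> simp [Config.add, Config.setZ, Config.remove, hz, hm]
      · rw [if_neg (show ¬ σ.1.w x + o = 1 by omega)] at hηx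
        rw [hηx]
        cases b <;> cases ξ x <;>
          simp [Config.add, Config.setZ, Config.remove, hm, h]

lemma iter_bind_canonical {L : ℕ} (p : Set.Ioo (0 : ℝ) 1) (e : Evolution L) (n : ℕ)
    (σ : State L) : (iter p e n σ).bind (canonical p) = canonical p σ := by
  induction n generalizing σ with
  | zero => rw [iter, PMF.pure_bind]
  | succ n ih =>
    rw [iter, PMF.bind_bind]
    simp only [ih]
    unfold step
    split_ifs with h
    · rw [PMF.pure_bind]
    · exact evolveAt_bind_canonical p _ σ (e.waiting σ.1 h)

lemma bind_congr_support {α β : Type*} (μ : PMF α) (f g : α → PMF β)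
    (h : ∀ a ∈ μ.support, f a = g a) : μ.bind f = μ.bind g := by
  ext b
  simp only [PMF.bind_apply]
  refine tsum_congr fun a => ?_
  by_cases ha : a ∈ μ.support
  · rw [h a ha]
  · rw [(PMF.apply_eq_zero_iff μ a).2 ha, zero_mul, zero_mul]

/-- The abelian property: the law of the stable state does not depend on the evolution rule. -/
theorem stabilize_eq_canonical {L : ℕ} (p : Set.Ioo (0 : ℝ) 1) (e : Evolution L) (σ : State L) :
    stabilize p e σ = canonical p σ := by
  rw [← iter_bind_canonical p e σ.1.potential σ, stabilize]
  conv_lhs => rw [← PMF.bind_pure (iter p e σ.1.potential σ)]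
  exact bind_congr_support _ _ _ fun τ hτ =>
    (canonical_of_stable p τ (stable_of_mem_iter p e _ σ τ le_rfl hτ)).symm

/-- The configuration which starts an avalanche. -/
def loaded {L : ℕ} (z : Site L → Bool) : Config L := Config.add 1 ⟨fun _ => 0, z⟩

/-- The occupation after an avalanche from `z` with fresh bits `ξ`. -/
def relax {L : ℕ} (z ξ : Site L → Bool) : Site L → Bool :=
  fun x => if inflow (loaded z) ξ x = 0 then z x else ξ x

lemma avalanche_eq {L : ℕ} (p : Set.Ioo (0 : ℝ) 1) (e : Evolution L) (z : Site L → Bool) :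
    avalanche p e z = (bits p (Site L)).map
      fun ξ => (relax z ξ, fun x : Site L => out (loaded z) ξ x) := by
  rw [avalanche, stabilize_eq_canonical, canonical, PMF.map_comp]
  congr 1
  funext ξ
  simp only [Function.comp_apply, settle, zero_add]
  rfl

/-! ### The successive avalanches as a function of independent bits -/

/-- The stable occupation before avalanche `u`, when `ζ 0` is the initial occupation and
`ζ (v + 1)` are the fresh bits of avalanche `v`. -/
def occ {L : ℕ} (ζ : ℕ → Site L → Bool) : ℕ → Site L → Bool
  | 0 => ζ 0
  | u + 1 => relax (occ ζ u) (ζ (u + 1))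

/-- The number of topplings at site `k` in avalanche `u`. -/
def top {L : ℕ} (ζ : ℕ → Site L → Bool) (u k : ℕ) : ℕ := out (loaded (occ ζ u)) (ζ (u + 1)) k

/-- The record of the first `n` avalanches. -/
def record {L : ℕ} (ζ : ℕ → Site L → Bool) (n : ℕ) : Record L :=
  (occ ζ n, fun u x => if u < n then top ζ u x else 0)

lemma occ_congr {L : ℕ} {ζ ζ' : ℕ → Site L → Bool} (u : ℕ) (h : ∀ i ≤ u, ζ' i = ζ i) :
    occ ζ' u = occ ζ u := by
  induction u with
  | zero => exact h 0 le_rfl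
  | succ u ih => rw [occ, occ, h _ le_rfl, ih fun i hi => h i (by omega)]

lemma record_congr {L : ℕ} {ζ ζ' : ℕ → Site L → Bool} (n : ℕ) (h : ∀ i ≤ n, ζ' i = ζ i) :
    record ζ' n = record ζ n := by
  refine Prod.ext (occ_congr n h) (funext fun u => funext fun x => ?_)
  simp only [record]
  split_ifs with hu
  · rw [top, top, h _ (by omega), occ_congr u fun i hi => h i (by omega)]
  · rfl

lemma record_succ {L : ℕ} (ζ : ℕ → Site L → Bool) (n : ℕ) :
    record ζ (n + 1) = (relax (record ζ n).1 (ζ (n + 1)), Function.update (record ζ n).2 n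
      fun x : Site L => out (loaded (record ζ n).1) (ζ (n + 1)) x) := by
  refine Prod.ext rfl (funext fun u => funext fun x => ?_)
  by_cases hu : u = n
  · subst hu
    simp [record, top]
  · simp [record, hu, show u ≤ n ↔ u < n by omega]

/-- The rows of a finite array of bits, continued by `false`. Rows beyond the array play no part in
the avalanches under consideration. -/
def rows {L N : ℕ} (η : Fin N × Site L → Bool) (i : ℕ) (x : Site L) : Bool :=
  if h : i < N then η (⟨i, h⟩, x) else false

lemma rows_extend_row {L N : ℕ} (η : Fin N × Site L → Bool) (i : Fin N) (ξ : Site L → Bool) :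
    rows (Function.extend (fun x => (i, x)) ξ η) = Function.update (rows η) i ξ := by
  have hinj : Function.Injective fun x : Site L => (i, x) := fun _ _ h => (Prod.ext_iff.1 h).2
  funext j x
  by_cases hj : j = i
  · subst hj
    rw [Function.update_self]
    simp only [rows, i.2, dif_pos]
    exact hinj.extend_apply ξ η x
  · rw [Function.update_of_ne hj]
    unfold rows
    split_ifs with h
    · rw [Function.extend_apply']
      rintro ⟨y, hy⟩
      exact hj (congrArg Fin.val (Prod.ext_iff.1 hy).1).symm
    · rfl

lemma rows_extend_column {L N : ℕ} (η : Fin N × Site L → Bool) (x : Site L) (c : Fin N → Bool)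
    (i : ℕ) (y : Site L) : rows (Function.extend (fun j => (j, x)) c η) i y
      = if y = x then (if h : i < N then c ⟨i, h⟩ else false) else rows η i y := by
  have hinj : Function.Injective fun j : Fin N => (j, x) := fun _ _ h => (Prod.ext_iff.1 h).1
  unfold rows
  split_ifs with h hy hy
  · subst hy
    exact hinj.extend_apply c η ⟨i, h⟩
  · rw [Function.extend_apply']
    rintro ⟨j, hj⟩
    exact hy (Prod.ext_iff.1 hj).2.symm
  · rfl
  · rfl

/-- The record of the avalanches has the law of `record` applied to independent bits. -/
theorem run_eq {L : ℕ} (p : Set.Ioo (0 : ℝ) 1) (e : Evolution L) (N n : ℕ) (hn : n < N) :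
    run L p e n = (bits p (Fin N × Site L)).map fun η => record (rows η) n := by
  have hrow : ∀ i : Fin N, Function.Injective fun x : Site L => (i, x) :=
    fun i _ _ h => (Prod.ext_iff.1 h).2
  induction n with
  | zero =>
    rw [run, stationary_eq_bits, ← PMF.bind_pure_comp, ← PMF.bind_pure_comp,
      ← bits_bind_extend p (hrow ⟨0, hn⟩)]
    simp only [Function.comp_apply, rows_extend_row]
    conv_lhs => rw [← PMF.bind_const (bits p (Fin N × Site L)) (PMF.bind _ _)]
    rfl
  | succ n ih =>
    rw [run, ih (by omega), PMF.bind_map, ← PMF.bind_pure_comp,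
      ← bits_bind_extend p (hrow ⟨n + 1, hn⟩) (PMF.pure ∘ fun η => record (rows η) (n + 1))]
    congr 1
    funext η
    rw [Function.comp_apply, avalanche_eq, PMF.map_comp, ← PMF.bind_pure_comp]
    congr 1
    funext ξ
    have hrec : record (Function.update (rows η) (n + 1) ξ) n = record (rows η) n :=
      record_congr n fun i hi => Function.update_of_ne (by omega) _ _
    simp only [Function.comp_apply, rows_extend_row, record_succ, hrec, Function.update_self]

lemma measurable_s {L : ℕ} (x t : ℕ) : Measurable (s x t : Record L → ℕ) := by
  unfold s
  split_ifs
  · fun_prop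
  · fun_prop

lemma measurableSet_toppled (L y t a : ℕ) : MeasurableSet (toppled L y t a) :=
  measurable_s y t (measurableSet_singleton a)

lemma measurableSet_reached (L y t τ : ℕ) : MeasurableSet (reached L y t τ) := by
  have : reached L y t τ = ⋃ u ∈ Set.Ioo t (t + τ), s y u ⁻¹' Set.Ici 1 := by
    ext ω
    simp [reached, and_assoc]
  rw [this]
  exact MeasurableSet.biUnion (Set.to_countable _) fun u _ => measurable_s y u measurableSet_Ici

/-- The bits which drive the avalanches `0, …, T`: the initial occupation, and one row of fresh
bits for each avalanche. -/
abbrev Noise (L T : ℕ) : Type := Fin (T + 2) × Site L → Bool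

lemma law_eq {L : ℕ} (p : Set.Ioo (0 : ℝ) 1) (e : Evolution L) (T : ℕ) :
    law L p e T = (bits p (Fin (T + 2) × Site L)).toMeasure.map
      fun η : Noise L T => record (rows η) (T + 1) := by
  rw [law, run_eq p e (T + 2) (T + 1) (by omega), PMF.toMeasure_map]
  exact measurable_of_finite _

lemma integral_law {L : ℕ} (p : Set.Ioo (0 : ℝ) 1) (e : Evolution L) (T : ℕ) {f : Record L → ℝ}
    (hf : Measurable f) :
    ∫ ω, f ω ∂(law L p e T) = mean p fun η : Noise L T => f (record (rows η) (T + 1)) := by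
  rw [law_eq, integral_map (measurable_of_finite _).aemeasurable hf.aestronglyMeasurable,
    integral_bits]

instance {L : ℕ} (p : Set.Ioo (0 : ℝ) 1) (e : Evolution L) (T : ℕ) :
    IsProbabilityMeasure (law L p e T) := by
  unfold law; infer_instance

lemma law_real {L : ℕ} (p : Set.Ioo (0 : ℝ) 1) (e : Evolution L) (T : ℕ) {S : Set (Record L)}
    (hS : MeasurableSet S) : (law L p e T).real S
      = mean p fun η : Noise L T => S.indicator 1 (record (rows η) (T + 1)) := by
  rw [← integral_law p e T (measurable_one.indicator hS), integral_indicator_one hS]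

lemma s_record {L : ℕ} (ζ : ℕ → Site L → Bool) {x u n : ℕ} (hx : 1 ≤ x) (hxL : x ≤ L)
    (hu : u < n) : s x u (record ζ n) = top ζ u x := by
  simp [s, hx, hxL, record, hu]

/-! ### The history of one site -/

/-- The number of particles that site `x` receives in avalanche `u`. -/
def arrivals {L : ℕ} (ζ : ℕ → Site L → Bool) (u : ℕ) (x : Site L) : ℕ :=
  inflow (loaded (occ ζ u)) (ζ (u + 1)) x

lemma top_site {L : ℕ} (ζ : ℕ → Site L → Bool) (u : ℕ) (x : Site L) :
    top ζ u x = flow (arrivals ζ u x) (occ ζ u x) (ζ (u + 1) x) := by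
  rw [top, out_site]; rfl

lemma occ_succ {L : ℕ} (ζ : ℕ → Site L → Bool) (u : ℕ) (x : Site L) :
    occ ζ (u + 1) x = if arrivals ζ u x = 0 then occ ζ u x else ζ (u + 1) x := rfl

lemma arrivals_first {L : ℕ} (ζ : ℕ → Site L → Bool) (u : ℕ) (x : Site L) (hx : (x : ℕ) = 1) :
    arrivals ζ u x = 1 := by
  simp [arrivals, inflow, loaded, Config.add, hx, out]

lemma arrivals_later {L : ℕ} (ζ : ℕ → Site L → Bool) (u : ℕ) (x : Site L) (hx : (x : ℕ) ≠ 1) :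
    arrivals ζ u x = top ζ u (x - 1) := by
  simp [arrivals, inflow, loaded, Config.add, hx, top]

/-- The outcome at the sites up to `k` is a function of the bits of these sites. -/
lemma occ_top_congr {L : ℕ} {ζ ζ' : ℕ → Site L → Bool} (k : ℕ)
    (h : ∀ i, ∀ y : Site L, (y : ℕ) ≤ k → ζ' i y = ζ i y) (u : ℕ) :
    (∀ y : Site L, (y : ℕ) ≤ k → occ ζ' u y = occ ζ u y) ∧ top ζ' u k = top ζ u k := by
  have htop : ∀ u, (∀ y : Site L, (y : ℕ) ≤ k → occ ζ' u y = occ ζ u y) →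
      ∀ j ≤ k, top ζ' u j = top ζ u j := fun u hu j hj =>
    out_congr j fun y hy => ⟨rfl, hu y (by omega), h _ y (by omega)⟩
  have hocc : ∀ u, ∀ y : Site L, (y : ℕ) ≤ k → occ ζ' u y = occ ζ u y := by
    intro u
    induction u with
    | zero => exact fun y hy => h 0 y hy
    | succ u ih =>
      intro y hy
      have harr : arrivals ζ' u y = arrivals ζ u y := by
        by_cases h1 : (y : ℕ) = 1
        · rw [arrivals_first _ _ _ h1, arrivals_first _ _ _ h1]
        · rw [arrivals_later _ _ _ h1, arrivals_later _ _ _ h1, htop u ih _ (by omega)]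
      rw [occ_succ, occ_succ, harr, ih y hy, h _ y hy]
  exact ⟨hocc u, htop u (hocc u) k le_rfl⟩

/-- The row from which the occupation before avalanche `u` was read, at a site where `n v`
particles arrive in avalanche `v`: `v + 1` for the last `v < u` with `n v ≠ 0`, if any. -/
def source (n : ℕ → ℕ) : ℕ → ℕ
  | 0 => 0
  | u + 1 => if n u = 0 then source n u else u + 1

lemma occ_eq_source {L : ℕ} (ζ : ℕ → Site L → Bool) (x : Site L) (u : ℕ) :
    occ ζ u x = ζ (source (fun v => arrivals ζ v x) u) x := by
  induction u with
  | zero => rfl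
  | succ u ih =>
    rw [occ_succ, source]
    split_ifs
    · exact ih
    · rfl

lemma source_le (n : ℕ → ℕ) (u : ℕ) : source n u ≤ u := by
  induction u with
  | zero => exact le_rfl
  | succ u ih => rw [source]; split_ifs <;> omega

/-- If the site is visited by avalanche `t`, its later occupations are read from row `t + 1` on, and
from row `t + 1` itself as long as it has not been visited again. -/
lemma source_add (n : ℕ → ℕ) {t : ℕ} (ht : n t ≠ 0) (k : ℕ) :
    t + 1 ≤ source n (t + 1 + k) ∧
      (source n (t + 1 + k) = t + 1 ↔ ∀ u, t < u → u < t + 1 + k → n u = 0) := by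
  induction k with
  | zero =>
    simp only [add_zero, source, ht, if_false, le_refl, true_and, true_iff]
    intro u h1 h2
    omega
  | succ k ih =>
    rw [← add_assoc, source]
    split_ifs with h
    · refine ⟨ih.1, ih.2.trans ⟨fun H u h1 h2 => ?_, fun H u h1 h2 => H u h1 (by omega)⟩⟩
      rcases Nat.lt_succ_iff_lt_or_eq.1 h2 with h3 | rfl
      · exact H u h1 h3
      · exact h
    · refine ⟨by omega, ⟨fun H => by omega, fun H => ?_⟩⟩
      exact absurd (H (t + 1 + k) (by omega) (by omega)) h

/-! ### The recursion of the two-point function -/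

lemma cast_flow {n : ℕ} (hn : n ≠ 0) (a b : Bool) :
    (flow n a b : ℝ) = n + a.toNat - b.toNat := by
  have : b.toNat ≤ n + a.toNat := by have := Bool.toNat_le b; omega
  rw [flow, if_neg hn, Nat.cast_sub this, Nat.cast_add]

/-- The avalanches `t` and `t + τ` reach a site where `n u` particles arrive in avalanche `u`, and
no avalanche between them does. -/
def Consecutive (n : ℕ → ℕ) (t τ : ℕ) : Prop :=
  n t ≠ 0 ∧ n (t + τ) ≠ 0 ∧ ∀ u, t < u → u < t + τ → n u = 0

open Classical in
/-- The average over the bits of one site of the product of its topplings in two avalanches, the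
arrivals `n` being given. The two net changes of occupation share a bit, and are then negatively
correlated, exactly when the later of the two avalanches is the first visit after the earlier. -/
lemma mean_flow_mul_flow (p : Set.Ioo (0 : ℝ) 1) (n : ℕ → ℕ) {t τ N : ℕ} (hτ : 1 ≤ τ)
    (hN : t + τ + 1 < N) (X : (Fin N → Bool) → ℕ → Bool)
    (hX : ∀ c i (h : i < N), X c i = c ⟨i, h⟩) :
    mean p (fun c : Fin N → Bool =>
        (flow (n t) (X c (source n t)) (X c (t + 1)) : ℝ)
          * flow (n (t + τ)) (X c (source n (t + τ))) (X c (t + τ + 1)))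
      = n t * n (t + τ) - p * (1 - p) * if Consecutive n t τ then 1 else 0 := by
  by_cases hA : n t = 0
  · simp [Consecutive, hA, flow, mean_const]
  by_cases hB : n (t + τ) = 0
  · simp [Consecutive, hB, flow, mean_const]
  obtain ⟨k, rfl⟩ : ∃ k, τ = 1 + k := ⟨τ - 1, by omega⟩
  obtain ⟨h1, h2⟩ := source_add n hA k
  have h3 := source_le n t
  have h4 := source_le n (t + (1 + k))
  rw [add_assoc] at h1 h2
  simp only [cast_flow hA, cast_flow hB]
  simp only [hX _ _ (show source n t < N by omega), hX _ _ (show t + 1 < N by omega),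
    hX _ _ (show source n (t + (1 + k)) < N by omega), hX _ _ hN]
  rw [mean_flux_mul_flux]
  · simp only [Consecutive, Fin.mk.injEq, h2, hA, hB, ne_eq, not_false_eq_true, true_and]
  all_goals
    intro h
    have := congrArg Fin.val h
    simp only at this
    omega

/-- The event that avalanches `t` and `t + τ` send particles from `y` to `y + 1`, and that no
avalanche between them does. -/
def returns (L y t τ : ℕ) : Set (Record L) :=
  (toppled L y t 0)ᶜ ∩ (toppled L y (t + τ) 0)ᶜ ∩ (reached L y t τ)ᶜ

lemma measurableSet_returns (L y t τ : ℕ) : MeasurableSet (returns L y t τ) :=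
  ((measurableSet_toppled L y t 0).compl.inter (measurableSet_toppled L y (t + τ) 0).compl).inter
    (measurableSet_reached L y t τ).compl

lemma record_mem_returns {L : ℕ} (ζ : ℕ → Site L → Bool) {y t τ : ℕ} (hy : 1 ≤ y) (hyL : y ≤ L) :
    record ζ (t + τ + 1) ∈ returns L y t τ ↔ Consecutive (fun u => top ζ u y) t τ := by
  have hs : ∀ u < t + τ + 1, s y u (record ζ (t + τ + 1)) = top ζ u y :=
    fun u hu => s_record ζ hy hyL hu
  simp only [returns, toppled, reached, Consecutive, Set.mem_inter_iff, Set.mem_compl_iff,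
    Set.mem_ofPred_eq, hs t (by omega), hs (t + τ) (by omega), and_assoc, not_exists, not_and,
    ne_eq]
  refine and_congr_right fun _ => and_congr_right fun _ => forall_congr' fun u =>
    forall_congr' fun _ => forall_congr' fun hu => ?_
  rw [hs u (by omega)]
  omega

lemma corr_eq_mean {L : ℕ} (p : Set.Ioo (0 : ℝ) 1) (e : Evolution L) {x t τ : ℕ} (hx : 1 ≤ x)
    (hxL : x ≤ L) : corr L p e x t τ
      = mean p fun η : Noise L (t + τ) => (top (rows η) t x : ℝ) * top (rows η) (t + τ) x := by
  have hm : ∀ u, Measurable fun ω : Record L => (s x u ω : ℝ) :=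
    fun u => measurable_from_nat.comp (measurable_s x u)
  have hm' : Measurable fun ω : Record L => (s x t ω : ℝ) * s x (t + τ) ω :=
    (hm t).mul (hm (t + τ))
  rw [corr, integral_law p e _ hm']
  congr 1
  funext η
  rw [s_record _ hx hxL (by omega), s_record _ hx hxL (by omega)]

/-- The recursion of the two-point function: passing a site costs `p (1 - p)` on the event that
the two avalanches are consecutive visits of the site. -/
theorem corr_succ {L : ℕ} (p : Set.Ioo (0 : ℝ) 1) (e : Evolution L) {x t τ : ℕ} (hτ : 1 ≤ τ)
    (hx : 2 ≤ x) (hxL : x ≤ L) : corr L p e x t τ = corr L p e (x - 1) t τ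
      - p * (1 - p) * (law L p e (t + τ)).real (returns L (x - 1) t τ) := by
  classical
  set x' : Site L := ⟨x, Finset.mem_Icc.2 ⟨by omega, hxL⟩⟩ with hx'
  have hinj : Function.Injective fun j : Fin (t + τ + 2) => (j, x') :=
    fun _ _ h => (Prod.ext_iff.1 h).1
  rw [corr_eq_mean p e (by omega) hxL, corr_eq_mean p e (show 1 ≤ x - 1 by omega) (by omega),
    law_real p e _ (measurableSet_returns L _ t τ), ← mean_mul_left, ← mean_sub,
    ← mean_extend p hinj]
  congr 1
  funext η
  -- The arrivals at `x` are fixed by the bits of the sites before `x`; average over those of `x`.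
  set n : ℕ → ℕ := fun u => top (rows η) u (x - 1) with hn
  have harr : ∀ c u, arrivals (rows (Function.extend (fun j => (j, x')) c η)) u x' = n u := by
    intro c u
    rw [arrivals_later _ _ _ (show x ≠ 1 by omega)]
    refine (occ_top_congr (x - 1) (fun i y hy => ?_) u).2
    have : y ≠ x' := by
      rintro rfl
      have : x ≤ x - 1 := hy
      omega
    rw [rows_extend_column, if_neg this]
  have htop : ∀ c u, top (rows (Function.extend (fun j => (j, x')) c η)) u x
      = flow (n u) (rows (Function.extend (fun j => (j, x')) c η) (source n u) x')
        (rows (Function.extend (fun j => (j, x')) c η) (u + 1) x') := by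
    intro c u
    have := top_site (rows (Function.extend (fun j => (j, x')) c η)) u x'
    rw [occ_eq_source] at this
    simpa only [harr] using this
  simp only [htop]
  rw [mean_flow_mul_flow p n hτ (by omega)
    (fun c i => rows (Function.extend (fun j => (j, x')) c η) i x')]
  · congr 2
    simp only [Set.indicator_apply, Pi.one_apply]
    exact if_congr (record_mem_returns _ (by omega) (by omega)).symm rfl rfl
  · intro c i h
    rw [rows_extend_column, if_pos rfl, dif_pos h]

/-! ### Conditional probabilities -/

lemma top_le {L : ℕ} (ζ : ℕ → Site L → Bool) (u k : ℕ) : top ζ u k ≤ k + 1 := by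
  induction k with
  | zero => exact Nat.zero_le _
  | succ k ih =>
    by_cases hk : k + 1 ∈ Finset.Icc 1 L
    · have h := top_site ζ u ⟨k + 1, hk⟩
      have harr : arrivals ζ u ⟨k + 1, hk⟩ ≤ k + 1 := by
        by_cases h1 : k + 1 = 1
        · rw [arrivals_first _ _ _ h1]; omega
        · rw [arrivals_later _ _ _ h1]; exact ih
      have hb := Bool.toNat_le (occ ζ u ⟨k + 1, hk⟩)
      simp only at h
      rw [h, flow]
      split_ifs <;> omega
    · simp [top, out, hk]

/-- The chain rule for conditional probabilities; both sides vanish if a condition is null. -/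
lemma one_sub_cond_mul_cond_mul {Ω : Type*} [MeasurableSpace Ω] (μ : Measure Ω)
    [IsProbabilityMeasure μ] {A R : Set Ω} (hA : MeasurableSet A) (hR : MeasurableSet R)
    (B : Set Ω) :
    (1 - (μ[|A]).real R) * (μ[|A ∩ Rᶜ]).real B * μ.real A = μ.real (A ∩ Rᶜ ∩ B) := by
  have hsplit : μ.real (A ∩ R) + μ.real (A ∩ Rᶜ) = μ.real A := by
    rw [← Set.sdiff_eq]; exact measureReal_inter_add_sdiff hR
  rw [measureReal_def, measureReal_def, cond_apply hA, cond_apply (hA.inter hR.compl),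
    ENNReal.toReal_mul, ENNReal.toReal_mul, ENNReal.toReal_inv, ENNReal.toReal_inv]
  simp only [← measureReal_def]
  by_cases h0 : μ.real A = 0
  · have : μ.real (A ∩ Rᶜ ∩ B) ≤ μ.real A :=
      measureReal_mono (Set.inter_subset_left.trans Set.inter_subset_left)
    rw [h0, mul_zero]
    exact le_antisymm measureReal_nonneg (this.trans h0.le)
  · have h1 : (1 - (μ.real A)⁻¹ * μ.real (A ∩ R)) * μ.real A = μ.real (A ∩ Rᶜ) := by
      field_simp
      linarith
    rw [mul_right_comm, h1]
    by_cases h2 : μ.real (A ∩ Rᶜ) = 0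
    · have : μ.real (A ∩ Rᶜ ∩ B) ≤ μ.real (A ∩ Rᶜ) := measureReal_mono Set.inter_subset_left
      rw [h2, zero_mul]
      exact le_antisymm measureReal_nonneg (this.trans h2.le)
    · field_simp

lemma real_returns_eq_sum {L : ℕ} (p : Set.Ioo (0 : ℝ) 1) (e : Evolution L) {y t τ : ℕ}
    (hy : 1 ≤ y) (hyL : y ≤ L) : (law L p e (t + τ)).real (returns L y t τ)
      = ∑ a ∈ Finset.Icc 1 (y + 1), ∑ b ∈ Finset.Icc 1 (y + 1), (law L p e (t + τ)).real
          (toppled L y t a ∩ (reached L y t τ)ᶜ ∩ toppled L y (t + τ) b) := by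
  classical
  have hm : ∀ a b, MeasurableSet
      (toppled L y t a ∩ (reached L y t τ)ᶜ ∩ toppled L y (t + τ) b) := fun a b =>
    ((measurableSet_toppled L y t a).inter (measurableSet_reached L y t τ).compl).inter
      (measurableSet_toppled L y (t + τ) b)
  rw [law_real p e _ (measurableSet_returns L y t τ)]
  simp only [law_real p e _ (hm _ _), ← mean_sum]
  congr 1
  funext η
  set ω := record (rows η) (t + τ + 1) with hω
  have h1 : s y t ω ≤ y + 1 := by rw [hω, s_record _ hy hyL (by omega)]; exact top_le _ _ _
  have h2 : s y (t + τ) ω ≤ y + 1 := by rw [hω, s_record _ hy hyL (by omega)]; exact top_le _ _ _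
  by_cases hr : ω ∈ reached L y t τ
  · simp [returns, hr]
  · have : ∀ a b, (toppled L y t a ∩ (reached L y t τ)ᶜ ∩ toppled L y (t + τ) b).indicator
        (1 : Record L → ℝ) ω
        = if s y t ω = a then (if s y (t + τ) ω = b then 1 else 0) else 0 := by
      intro a b
      simp only [Set.indicator_apply, Set.mem_inter_iff, Set.mem_compl_iff, hr, toppled,
        Set.mem_ofPred_eq, not_false_eq_true, and_true, Pi.one_apply, ite_and]
    simp only [this, Finset.sum_ite_irrel, Finset.sum_ite_eq, Finset.sum_const_zero,
      Finset.mem_Icc, h1, h2, and_true]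
    simp only [Set.indicator_apply, returns, Set.mem_inter_iff, Set.mem_compl_iff, hr, toppled,
      Set.mem_ofPred_eq, not_false_eq_true, and_true, Pi.one_apply, ite_and,
      Nat.one_le_iff_ne_zero, ne_eq]

/-! ### Strict decrease -/

/-- Bits for which the avalanches `t` and `t + τ` are consecutive visits of `y + 1`: the sites up
to `y` are empty after avalanche `t`, avalanche `t + j` stops at site `y + 1 - j` for
`1 ≤ j < τ`, and avalanche `t + τ` sweeps the occupied sites. Row `i = t + j + 1` holds the fresh
bits of avalanche `t + j`, whence the equation `z + i = y + t + 2`. -/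
def fillingBits (y t τ : ℕ) (i z : ℕ) : Bool := decide (t + 2 ≤ i ∧ i ≤ t + τ ∧ z + i = y + t + 2)

/-- Under `fillingBits`, the pattern of the arrivals at a site determines that of its topplings:
avalanche `t + j` passes the site if and only if it is to stop further on. -/
lemma top_fillingBits_of_arrivals {L : ℕ} {y t τ : ℕ} (z : Site L) (hz : (z : ℕ) ≤ y)
    {ζ : ℕ → Site L → Bool} (hζ : ∀ i x, ζ i x = fillingBits y t τ i x)
    (h1 : ∀ u ≤ t, arrivals ζ u z = 1)
    (h2 : ∀ j, 1 ≤ j → j < τ → arrivals ζ (t + j) z = if (z : ℕ) + j ≤ y + 1 then 1 else 0)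
    (h3 : arrivals ζ (t + τ) z ≠ 0) :
    (∀ u ≤ t, top ζ u z = 1) ∧
      (∀ j, 1 ≤ j → j < τ → top ζ (t + j) z = if (z : ℕ) + j ≤ y then 1 else 0) ∧
      top ζ (t + τ) z ≠ 0 := by
  have hocc : ∀ u ≤ t + 1, occ ζ u z = false := by
    intro u hu
    cases u with
    | zero => rw [occ, hζ, fillingBits, decide_eq_false_iff_not]; omega
    | succ u =>
      rw [occ_succ, h1 u (by omega), if_neg one_ne_zero, hζ, fillingBits,
        decide_eq_false_iff_not]
      omega
  -- After avalanche `t + j` the last `j` of the sites `1, …, y` are occupied.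
  have hocc' : ∀ j < τ, occ ζ (t + 1 + j) z = decide (y + 1 ≤ (z : ℕ) + j) := by
    intro j hj
    induction j with
    | zero => rw [add_zero, hocc _ le_rfl, eq_comm, decide_eq_false_iff_not]; omega
    | succ j ih =>
      have := h2 (j + 1) (by omega) hj
      rw [show t + (j + 1) = t + 1 + j by ring] at this
      rw [← add_assoc, occ_succ, this, ih (by omega), hζ, fillingBits]
      by_cases h4 : (z : ℕ) + (j + 1) ≤ y + 1
      · rw [if_pos h4, if_neg one_ne_zero, decide_eq_decide]
        omega
      · rw [if_neg h4, if_pos rfl, decide_eq_decide]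
        omega
  refine ⟨fun u hu => ?_, fun j hj hjτ => ?_, ?_⟩
  · have hb : ζ (u + 1) z = false := by
      rw [hζ, fillingBits, decide_eq_false_iff_not]; omega
    rw [top_site, h1 u hu, hocc u (by omega), hb]
    rfl
  · have ho := hocc' (j - 1) (by omega)
    rw [show t + 1 + (j - 1) = t + j by omega] at ho
    rw [top_site, h2 j hj hjτ, ho, hζ, fillingBits, flow]
    by_cases h4 : (z : ℕ) + j ≤ y + 1
    · have h5 : ¬ (y + 1 ≤ (z : ℕ) + (j - 1)) := by omega
      by_cases h6 : (z : ℕ) + j ≤ y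
      · have h7 : ¬ ((z : ℕ) + (t + j + 1) = y + t + 2) := by omega
        simp [h4, h5, h6, h7]
      · have h7 : (z : ℕ) + (t + j + 1) = y + t + 2 := by omega
        have h8 : t + 2 ≤ t + j + 1 ∧ t + j + 1 ≤ t + τ := by omega
        simp [h4, h5, h6, h7, h8]
    · simp [h4, show ¬ ((z : ℕ) + j ≤ y) by omega]
  · have hb : ζ (t + τ + 1) z = false := by
      rw [hζ, fillingBits, decide_eq_false_iff_not]; omega
    rw [top_site, hb, flow, if_neg h3]
    simp [h3]

lemma consecutive_fillingBits {L : ℕ} {y t τ : ℕ} (hτy : τ ≤ y + 1) (hy : 1 ≤ y)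
    (hyL : y ≤ L) {ζ : ℕ → Site L → Bool} (hζ : ∀ i x, ζ i x = fillingBits y t τ i x) :
    Consecutive (fun u => top ζ u y) t τ := by
  have key : ∀ k, 1 ≤ k → k ≤ y → (∀ u ≤ t, top ζ u k = 1) ∧
      (∀ j, 1 ≤ j → j < τ → top ζ (t + j) k = if k + j ≤ y then 1 else 0) ∧
      top ζ (t + τ) k ≠ 0 := by
    intro k hk
    induction k, hk using Nat.le_induction with
    | base =>
      intro hy
      refine top_fillingBits_of_arrivals ⟨1, Finset.mem_Icc.2 ⟨le_rfl, by omega⟩⟩ hy hζ ?_ ?_ ?_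
      · intro u _
        exact arrivals_first _ _ _ rfl
      · intro j _ hj
        rw [arrivals_first _ _ _ rfl, if_pos (by show 1 + j ≤ y + 1; omega)]
      · rw [arrivals_first _ _ _ rfl]
        exact one_ne_zero
    | succ k hk ih =>
      intro hky
      obtain ⟨i1, i2, i3⟩ := ih (by omega)
      have harr : ∀ u, arrivals ζ u ⟨k + 1, Finset.mem_Icc.2 ⟨by omega, by omega⟩⟩ = top ζ u k :=
        fun u => arrivals_later _ _ _ (show k + 1 ≠ 1 by omega)
      refine top_fillingBits_of_arrivals ⟨k + 1, Finset.mem_Icc.2 ⟨by omega, by omega⟩⟩ hky hζ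
        ?_ ?_ ?_
      · intro u hu
        rw [harr, i1 u hu]
      · intro j hj hjτ
        rw [harr, i2 j hj hjτ]
        exact if_congr (by show k + j ≤ y ↔ k + 1 + j ≤ y + 1; omega) rfl rfl
      · rwa [harr]
  obtain ⟨k1, k2, k3⟩ := key y hy le_rfl
  refine ⟨by simp [k1], k3, fun u h1 h2 => ?_⟩
  have := k2 (u - t) (by omega) (by omega)
  rw [show t + (u - t) = u by omega, if_neg (by omega)] at this
  exact this

/-- If `τ ≤ y + 1`, the `τ - 1` avalanches in between can all come to rest in the `y` sites
`1, …, y`. -/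
lemma real_returns_pos {L : ℕ} (p : Set.Ioo (0 : ℝ) 1) (e : Evolution L) {y t τ : ℕ}
    (hτy : τ ≤ y + 1) (hy : 1 ≤ y) (hyL : y ≤ L) :
    0 < (law L p e (t + τ)).real (returns L y t τ) := by
  rw [law_real p e _ (measurableSet_returns L y t τ)]
  refine mean_pos p (fun η => Set.indicator_nonneg (fun _ _ => zero_le_one) _)
    (fun i => fillingBits y t τ i.1 i.2) ?_
  rw [Set.indicator_of_mem]
  · exact one_pos
  · refine (record_mem_returns _ hy hyL).2 (consecutive_fillingBits hτy hy hyL fun i x => ?_)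
    unfold rows
    split_ifs with h
    · rfl
    · rw [fillingBits, eq_comm, decide_eq_false_iff_not]
      omega

end DSS

theorem mainTheorem5 (L : ℕ) (p : Set.Ioo (0 : ℝ) 1) (e : DSS.Evolution L) (t τ : ℕ)
    (hτ : 1 ≤ τ) :
    (∀ x : ℕ, 2 ≤ x → x ≤ L →
      DSS.corr L p e x t τ = DSS.corr L p e (x - 1) t τ
        - (p : ℝ) * (1 - (p : ℝ)) *
          ∑ a ∈ Finset.Icc 1 x, ∑ b ∈ Finset.Icc 1 x,
            (1 - DSS.theta L p e (x - 1) t τ a)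
              * ((DSS.law L p e (t + τ))[|DSS.toppled L (x - 1) t a
                  ∩ (DSS.reached L (x - 1) t τ)ᶜ]).real (DSS.toppled L (x - 1) (t + τ) b)
              * (DSS.law L p e (t + τ)).real (DSS.toppled L (x - 1) t a)) ∧
    AntitoneOn (fun x : ℕ => DSS.corr L p e x t τ) (Set.Icc 1 L) ∧
    (∀ x : ℕ, 2 ≤ x → x ≤ L → τ ≤ x →
      DSS.corr L p e x t τ < DSS.corr L p e (x - 1) t τ) := by
  have hα : 0 < (p : ℝ) * (1 - p) := mul_pos p.2.1 (by linarith [p.2.2])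
  refine ⟨fun x hx hxL => ?_, ?_, fun x hx hxL hτx => ?_⟩
  · obtain ⟨y, rfl⟩ : ∃ y, x = y + 1 := ⟨x - 1, by omega⟩
    rw [DSS.corr_succ p e hτ hx hxL]
    simp only [Nat.add_sub_cancel]
    rw [DSS.real_returns_eq_sum p e (by omega) (by omega)]
    simp only [DSS.theta, DSS.one_sub_cond_mul_cond_mul _ (DSS.measurableSet_toppled L y t _)
      (DSS.measurableSet_reached L y t τ)]
  · refine antitoneOn_of_succ_le Set.ordConnected_Icc fun x _ hx hx1 => ?_
    rw [Nat.succ_eq_succ] at hx1 ⊢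
    have h := DSS.corr_succ p e (t := t) hτ (x := x + 1) (by have := hx.1; omega) hx1.2
    rw [Nat.add_sub_cancel] at h
    simp only [Nat.succ_eq_add_one]
    rw [h]
    have := mul_nonneg hα.le
      (measureReal_nonneg (μ := DSS.law L p e (t + τ)) (s := DSS.returns L x t τ))
    linarith
  · rw [DSS.corr_succ p e hτ hx hxL]
    have := mul_pos hα (DSS.real_returns_pos p e (t := t)
      (show τ ≤ x - 1 + 1 by omega) (by omega) (by omega))
    linarith
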